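/- Fix $\lambda_p>0$, $d>0$ and $0<R_{tx}<R_{cs}$. Consider the Poisson bipolar model: a homogeneous Poisson point process $\Phi_{PPP}=\{x_i\}$ on $\mathbb R^2$ of intensity $\lambda_p$ (the potential transmitters, enumerated without repetition), whose points carry independent marks $\theta_i$, uniform on $[0,2\pi]$ and independent of the locations; the receiver of $x_i$ is $x_i+d(\cos\theta_i,\sin\theta_i)$. The exclusion region of a pair $(x,\theta)$ is $$A(x,\theta)=\bar B_{x}(R_{cs})\cup \bar B_{x+d(\cos\theta,\sin\theta)}(R_{tx}),$$ where $\bar B_x(r)$ is the closed disk of radius $r$ about $x$. The Type I dual-zone hard-core process $\Phi$ consists of those $x_i$ for which no $x_j$, $j\ne i$, lies in $A(x_i,\theta_i)$ (the active transmitters). Let $$V_o=(\pi-\xi_1)R_{cs}^2+(\pi-\xi_2)R_{tx}^2+d\,R_{cs}\sin\xi_1,\qquad \xi_1=\arccos\frac{d^2+R_{cs}^2-R_{tx}^2}{2dR_{cs}},\quad \xi_2=\arccos\frac{d^2+R_{tx}^2-R_{cs}^2}{2dR_{tx}},$$ with the convention $\arccos t=0$ for $t>1$ and $\arccos t=\pi$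 for $t<-1$ (needed only if one disk contains the other or the disks are disjoint). Then: 1. $V_o$ is the area of $A(x,\theta)$, for all $x$ and $\theta$. 2. $\Phi$ has intensity $\lambda=\lambda_p e^{-\lambda_p V_o}$, that is, $\mathbb E\,\#(\Phi\cap B)=\lambda_p e^{-\lambda_pV_o}\,|B|$ for every Borel set $B\subseteq\mathbb R^2$. 3. $\lambda=\lambda_p\,P_o(o\in\Phi)$ and $P_o(o\in\Phi)=e^{-\lambda_pV_o}$, where $P_o$ is the Palm distribution of the marked process $\{(x_i,\theta_i)\}$: for an event $Y$ and any Borel set $B$ with $0<|B|<\infty$, $P_o(Y)=\frac1{\lambda_p|B|}\,\mathbb E\sum_{x\in\Phi_{PPP}\cap B}\mathbf 1_Y(\{(x_i-x,\theta_i)\}_i)$. -/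

import Mathlib

open MeasureTheory ProbabilityTheory
open scoped ENNReal

noncomputable section

/-- The Euclidean plane. -/
abbrev Plane : Type := EuclideanSpace ℝ (Fin 2)

/-- A marked pattern: a set of pairs `(x, θ)`, with `x` the location of a transmitter and `θ` the
orientation of its receiver. -/
abbrev MarkedPattern : Type := Set (Plane × ℝ)

namespace DualZone

/-! ### Point processes in the plane -/

/-- `Φ` is a homogeneous Poisson point process of intensity `lam` in the plane: the number of its
points in a Borel set is a random variable, it is Poisson distributed with mean `lam * |B|` when
`|B| < ∞`, and the numbers in pairwise disjoint Borel sets are independent. -/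
structure IsPoissonProcess {Ω : Type*} [MeasurableSpace Ω] (P : Measure Ω)
    (Φ : Ω → Set Plane) (lam : ℝ) : Prop where
  measurable_count : ∀ B : Set Plane, MeasurableSet B →
    Measurable (fun ω => (Φ ω ∩ B).encard)
  poisson_count : ∀ B : Set Plane, MeasurableSet B → volume B < ∞ → ∀ k : ℕ,
    P {ω | (Φ ω ∩ B).encard = (k : ℕ∞)} =
      poissonMeasure (Real.toNNReal (lam * (volume B).toReal)) {k}
  indep_count : ∀ (n : ℕ) (B : Fin n → Set Plane), (∀ i, MeasurableSet (B i)) →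
    Pairwise (fun i j => Disjoint (B i) (B j)) →
    iIndepFun (fun (i : Fin n) (ω : Ω) => (Φ ω ∩ B i).encard) P

/-- The (random) set of points enumerated by the sequence `X`. -/
def pointSet {Ω : Type*} (X : ℕ → Ω → Plane) (ω : Ω) : Set Plane :=
  Set.range (fun i => X i ω)

/-- The (random) set of marked points `(X i, θ i)`. -/
def markedSet {Ω : Type*} (X : ℕ → Ω → Plane) (θ : ℕ → Ω → ℝ) (ω : Ω) : MarkedPattern :=
  Set.range (fun i => (X i ω, θ i ω))

/-- The Poisson bipolar model: `X` enumerates without repetition the points of a homogeneous Poisson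
process of intensity `lam` (the potential transmitters), and the orientations `θ i` are independent,
uniformly distributed on `[0, 2π]`, and independent of the locations. -/
structure IsPoissonBipolar {Ω : Type*} [MeasurableSpace Ω] (P : Measure Ω)
    (X : ℕ → Ω → Plane) (θ : ℕ → Ω → ℝ) (lam : ℝ) : Prop where
  measurable_location : ∀ i, Measurable (X i)
  measurable_orientation : ∀ i, Measurable (θ i)
  injective : ∀ᵐ ω ∂P, Function.Injective (fun i => X i ω)
  poisson : IsPoissonProcess P (pointSet X) lam
  uniform : ∀ i, pdf.IsUniform (θ i) (Set.Icc 0 (2 * Real.pi)) P volume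
  indep_orientation : iIndepFun θ P
  indep_location : IndepFun (fun (ω : Ω) (i : ℕ) => X i ω) (fun (ω : Ω) (i : ℕ) => θ i ω) P

/-- `Φ` has intensity `lam`: the expected number of its points in each Borel set `B` is
`lam * |B|`. -/
def HasIntensity {Ω : Type*} [MeasurableSpace Ω] (P : Measure Ω)
    (Φ : Ω → Set Plane) (lam : ℝ≥0∞) : Prop :=
  ∀ B : Set Plane, MeasurableSet B →
    ∫⁻ ω, (((Φ ω ∩ B).encard : ℕ∞) : ℝ≥0∞) ∂P = lam * volume B

/-! ### Exclusion regions and Type I thinning -/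

/-- The receiver of the transmitter at `x` with orientation `θ`, at distance `d`. -/
def receiver (d : ℝ) (x : Plane) (θ : ℝ) : Plane :=
  x + !₂[d * Real.cos θ, d * Real.sin θ]

/-- The exclusion region of a pair: the disk of radius `Rcs` about the transmitter together with the
disk of radius `Rtx` about the receiver. -/
def exclusionRegion (d Rcs Rtx : ℝ) (x : Plane) (θ : ℝ) : Set Plane :=
  Metric.closedBall x Rcs ∪ Metric.closedBall (receiver d x θ) Rtx

/-- The pairs of `ψ` other than `p` whose transmitter lies in the exclusion region of `p`. -/
def neighborhood (d Rcs Rtx : ℝ) (ψ : MarkedPattern) (p : Plane × ℝ) : MarkedPattern :=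
  {q | q ∈ ψ ∧ q.1 ∈ exclusionRegion d Rcs Rtx p.1 p.2 ∧ q ≠ p}

open Classical in
/-- The medium access indicator: `1` if the neighborhood has no elements, else `0`. -/
def accessIndicator (d Rcs Rtx : ℝ) (ψ : MarkedPattern) (p : Plane × ℝ) : ℕ :=
  if (neighborhood d Rcs Rtx ψ p).encard = 0 then 1 else 0

/-- The pairs retained by Type I thinning. -/
def retainedPairs (d Rcs Rtx : ℝ) (ψ : MarkedPattern) : MarkedPattern :=
  {p | p ∈ ψ ∧ accessIndicator d Rcs Rtx ψ p = 1}

/-- The active transmitters after Type I thinning (the Type I dual-zone hard-core process, when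
`ψ` is a realization of the Poisson bipolar model). -/
def activeTransmitters (d Rcs Rtx : ℝ) (ψ : MarkedPattern) : Set Plane :=
  Prod.fst '' retainedPairs d Rcs Rtx ψ

/-! ### Palm distribution -/

/-- The pattern `ψ` translated by `-x`; orientations are unchanged. -/
def shift (ψ : MarkedPattern) (x : Plane) : MarkedPattern :=
  (fun q : Plane × ℝ => (q.1 - x, q.2)) '' ψ

/-- The Palm probability of the event `Y`, computed with the window `B`, for a marked process `Ψ`
whose process of locations has intensity `lam`:
`(lam * |B|)⁻¹ * 𝔼 [∑ x, 1_Y (Ψ - x)]`, the sum being over the locations `x ∈ B` of `Ψ`. -/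
def palmProb {Ω : Type*} [MeasurableSpace Ω] (P : Measure Ω) (Ψ : Ω → MarkedPattern)
    (lam : ℝ) (B : Set Plane) (Y : Set MarkedPattern) : ℝ≥0∞ :=
  (∫⁻ ω, ∑' x : ↥(Prod.fst '' Ψ ω ∩ B), Y.indicator (fun _ => (1 : ℝ≥0∞)) (shift (Ψ ω) x) ∂P) /
    (ENNReal.ofReal lam * volume B)

/-! ### The area of the exclusion region -/

/-- Angle at the transmitter. `Real.arccos` is `0` on `[1, ∞)` and `π` on `(-∞, -1]`. -/
def xi₁ (d Rcs Rtx : ℝ) : ℝ :=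
  Real.arccos ((d ^ 2 + Rcs ^ 2 - Rtx ^ 2) / (2 * d * Rcs))

/-- Angle at the receiver. -/
def xi₂ (d Rcs Rtx : ℝ) : ℝ :=
  Real.arccos ((d ^ 2 + Rtx ^ 2 - Rcs ^ 2) / (2 * d * Rtx))

/-- The closed form `V_o`. -/
def exclusionArea (d Rcs Rtx : ℝ) : ℝ :=
  (Real.pi - xi₁ d Rcs Rtx) * Rcs ^ 2 + (Real.pi - xi₂ d Rcs Rtx) * Rtx ^ 2
    + d * Rcs * Real.sin (xi₁ d Rcs Rtx)

end DualZone

end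

/-!
Three independent arguments are combined.

*Area.* After a rigid motion the exclusion region is the union of the disks of radii `R₁` about `0`
and `R₂` about `d` in `ℂ`. The radical axis `re z = a`, with `a = (d² + R₁² - R₂²) / (2d)`, cuts
this union into two circular segments, since to the left of it the second disk lies in the first,
and to the right the first lies in the second. A segment has area
`R² (π - arccos (a / R)) + a √(R² - a²)` (`volume_segment`), an identity that holds, with the
conventions for `arccos` and `√`, even if the line misses the disk. Hence no case distinction on the
relative position of the disks is needed, and the two segments add up to `exclusionArea`
(`segmentArea_add_segmentArea`, `volume_exclusionRegion`).

*Isolated points for a fixed orientation.* Fix `t`. The expected number of points of the Poisson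
process in `B` that are alone in their region `A(x, t)` is `λ |B| exp (-λ V)`
(`tsum_isolatedEvent`). Cut the plane into Borel cells of diameter at most `ε`, and let `C` be the
part of `B` in a cell, `c ∈ C`. The regions `A(x, t)`, `x ∈ C`, all lie between the regions `D⁻` and
`D⁺` of `c` with radii changed by `-ε` and `+ε`. So the number of isolated points in `C` is at least
the indicator that `C` has one point and `D⁺ \ C` none, and at most the indicator that `C` has one
point and `D⁻ \ C` none. As `C ⊆ D`, the probability of such an event is exactly
`λ |C| exp (-λ |D|)`; summing over the cells and letting `ε → 0` gives the claim by continuity of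
`exclusionArea` in the radii. This replaces the Mecke formula.

*Marks and Palm probability.* The orientation of a point is independent of all locations and its law
does not depend on the index, so by Fubini the expected number of active transmitters is the average
over `t` of the quantity above, which does not depend on `t` (`IsPoissonBipolar.hasIntensity`).
Thinning commutes with translations, so the sum in the Palm probability is the number of active
transmitters in the window (`tsum_indicator_shift_eq_encard`).
-/

namespace DualZone

/-! ### The area of a circular segment and of a union of two disks -/

/-- The area of the part of a disk of radius `R` lying to the left of the line at signed distance
`a` from the center. Since `Real.arccos` is clamped and `Real.sqrt` vanishes on negative numbers,
the formula is right also when the line misses the disk. -/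
noncomputable def segmentArea (R a : ℝ) : ℝ :=
  R ^ 2 * (Real.pi - Real.arccos (a / R)) + a * √(R ^ 2 - a ^ 2)

theorem hasDerivAt_segmentArea {R x : ℝ} (hR : 0 < R) (h₁ : x ≠ -R) (h₂ : x ≠ R) :
    HasDerivAt (segmentArea R) (2 * √(R ^ 2 - x ^ 2)) x := by
  rcases lt_or_ge (R ^ 2) (x ^ 2) with hlt | hge
    -- Outside the disk the function is locally constant.
  · have hcond : ∀ᶠ y in nhds x, R ^ 2 < y ^ 2 :=
      (continuous_pow 2).continuousAt.eventually (lt_mem_nhds hlt)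
    rw [Real.sqrt_eq_zero_of_nonpos (by linarith), mul_zero]
    rcases lt_or_ge x 0 with hx | hx
    · refine (hasDerivAt_const x (0 : ℝ)).congr_of_eventuallyEq ?_
      filter_upwards [hcond, gt_mem_nhds hx] with y hy hy0
      have : y / R ≤ -1 := by rw [div_le_iff₀ hR]; nlinarith
      simp [segmentArea, Real.arccos_of_le_neg_one this,
        Real.sqrt_eq_zero_of_nonpos (by linarith : R ^ 2 - y ^ 2 ≤ 0)]
    · have hx' : 0 < x := lt_of_le_of_ne hx (by rintro rfl; nlinarith)
      refine (hasDerivAt_const x (R ^ 2 * Real.pi)).congr_of_eventuallyEq ?_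
      filter_upwards [hcond, lt_mem_nhds hx'] with y hy hy0
      have : 1 ≤ y / R := by rw [le_div_iff₀ hR]; nlinarith
      simp [segmentArea, Real.arccos_of_one_le this,
        Real.sqrt_eq_zero_of_nonpos (by linarith : R ^ 2 - y ^ 2 ≤ 0)]
  · have hpos : 0 < R ^ 2 - x ^ 2 := by
      rcases hge.lt_or_eq with h | h
      · linarith
      · rcases sq_eq_sq_iff_eq_or_eq_neg.1 h with h | h <;> contradiction
    have hs : 0 < √(R ^ 2 - x ^ 2) := Real.sqrt_pos.2 hpos
    have hne1 : x / R ≠ -1 := by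
      intro h; apply h₁; field_simp at h; linarith
    have hne2 : x / R ≠ 1 := by
      intro h; apply h₂; field_simp at h; linarith
    have hacos := (Real.hasDerivAt_arccos hne1 hne2).comp x ((hasDerivAt_id x).div_const R)
    have hsqrt := (((hasDerivAt_id x).pow 2).const_sub (R ^ 2)).sqrt hpos.ne'
    have h := ((hacos.const_sub Real.pi).const_mul (R ^ 2)).add ((hasDerivAt_id x).mul hsqrt)
    have hq : √(1 - (x / R) ^ 2) = √(R ^ 2 - x ^ 2) / R := by
      rw [show 1 - (x / R) ^ 2 = (R ^ 2 - x ^ 2) / R ^ 2 by field_simp,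
        Real.sqrt_div hpos.le, Real.sqrt_sq hR.le]
    refine h.congr_deriv ?_
    simp only [id, hq]
    have hsq := Real.sq_sqrt hpos.le
    simp only [Pi.pow_apply, id]
    set s := √(R ^ 2 - x ^ 2)
    field_simp
    push_cast
    linear_combination (-2) * hsq

theorem continuous_segmentArea (R : ℝ) : Continuous (segmentArea R) := by
  unfold segmentArea
  fun_prop

theorem segmentArea_of_le_neg {R a : ℝ} (hR : 0 < R) (ha : a ≤ -R) : segmentArea R a = 0 := by
  have : a / R ≤ -1 := by rw [div_le_iff₀ hR]; linarith
  simp [segmentArea, Real.arccos_of_le_neg_one this,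
    Real.sqrt_eq_zero_of_nonpos (by nlinarith : R ^ 2 - a ^ 2 ≤ 0)]

theorem intervalIntegral_chord {R b : ℝ} (hR : 0 < R) (hb : b ≤ -R) (a : ℝ) :
    ∫ x in b..a, 2 * √(R ^ 2 - x ^ 2) = segmentArea R a := by
  have hcont : Continuous fun x : ℝ => 2 * √(R ^ 2 - x ^ 2) := by fun_prop
  rw [integral_eq_of_hasDerivAt_off_countable (segmentArea R) _
      (s := {-R, R}) ((Set.countable_singleton R).insert _)
      (continuous_segmentArea R).continuousOn
      (fun x hx => hasDerivAt_segmentArea hR (fun h => hx.2 (by simp [h]))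
        (fun h => hx.2 (by simp [h]))) (hcont.intervalIntegrable _ _),
    segmentArea_of_le_neg hR hb, sub_zero]

theorem segmentArea_nonneg {R : ℝ} (hR : 0 < R) (a : ℝ) : 0 ≤ segmentArea R a := by
  rw [← intervalIntegral_chord hR (min_le_right a (-R))]
  exact intervalIntegral.integral_nonneg (min_le_left _ _) fun x _ => by positivity

/-- `2 * √(R ^ 2 - x ^ 2)` is the length of the chord at abscissa `x`, also when the chord is
empty. -/
theorem lintegral_Iic_chord {R : ℝ} (hR : 0 < R) (a : ℝ) :
    ∫⁻ x in Set.Iic a, ENNReal.ofReal (2 * √(R ^ 2 - x ^ 2)) =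
      ENNReal.ofReal (segmentArea R a) := by
  set b : ℝ := min a (-R) with hb
  have hba : b ≤ a := min_le_left _ _
  have hbR : b ≤ -R := min_le_right _ _
  have hcont : Continuous fun x : ℝ => 2 * √(R ^ 2 - x ^ 2) := by fun_prop
  -- The chord is empty to the left of `-R`.
  have hsplit : ∫⁻ x in Set.Iic a, ENNReal.ofReal (2 * √(R ^ 2 - x ^ 2)) =
      ∫⁻ x in Set.Ioc b a, ENNReal.ofReal (2 * √(R ^ 2 - x ^ 2)) := by
    rw [← Set.Iic_union_Ioc_eq_Iic hba, lintegral_union (A := Set.Iic b) measurableSet_Ioc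
      (Set.disjoint_left.2 fun x hx hx' => not_lt.2 hx hx'.1),
      setLIntegral_eq_zero measurableSet_Iic, zero_add]
    intro x hx
    have : x ≤ -R := le_trans hx hbR
    simp [Real.sqrt_eq_zero_of_nonpos (by nlinarith : R ^ 2 - x ^ 2 ≤ 0)]
  rw [hsplit, ← ofReal_integral_eq_lintegral_ofReal
    ((hcont.integrableOn_Icc (a := b) (b := a)).mono_set Set.Ioc_subset_Icc_self)
    (Filter.Eventually.of_forall fun x => by positivity),
    ← intervalIntegral.integral_of_le hba,
    intervalIntegral_chord hR hbR]

/-- The area of a circular segment, as a subset of the complex plane. The half-line `I` may be open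
or closed: of two segments with a common chord only one is to contain it. -/
theorem volume_segment {R : ℝ} (hR : 0 < R) (a : ℝ) {I : Set ℝ} (hI : MeasurableSet I)
    (hIa : I =ᵐ[volume] Set.Iic a) :
    volume (Metric.closedBall (0 : ℂ) R ∩ Complex.re ⁻¹' I) =
      ENNReal.ofReal (segmentArea R a) := by
  have hS : MeasurableSet {p : ℝ × ℝ | p.1 ^ 2 + p.2 ^ 2 ≤ R ^ 2 ∧ p.1 ∈ I} :=
    (measurableSet_le (f := fun p : ℝ × ℝ => p.1 ^ 2 + p.2 ^ 2) (g := fun _ => R ^ 2)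
      (by fun_prop) (by fun_prop)).inter (measurable_fst hI)
  have hpre : Metric.closedBall (0 : ℂ) R ∩ Complex.re ⁻¹' I =
      Complex.measurableEquivRealProd ⁻¹' {p : ℝ × ℝ | p.1 ^ 2 + p.2 ^ 2 ≤ R ^ 2 ∧ p.1 ∈ I} := by
    ext z
    have : ‖z‖ ≤ R ↔ z.re ^ 2 + z.im ^ 2 ≤ R ^ 2 := by
      rw [← abs_of_pos hR, ← sq_le_sq₀ (norm_nonneg _) (abs_nonneg _), sq_abs, Complex.sq_norm,
        Complex.normSq_apply]
      ring_nf
    simp [Complex.measurableEquivRealProd_apply, this]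
  rw [hpre, Complex.volume_preserving_equiv_real_prod.measure_preimage_equiv,
    Measure.volume_eq_prod, Measure.prod_apply hS, ← lintegral_Iic_chord hR,
    ← setLIntegral_congr hIa, ← lintegral_indicator hI]
  refine lintegral_congr fun x => ?_
  by_cases hx : x ∈ I
  · rw [Set.indicator_of_mem hx]
    by_cases h0 : 0 ≤ R ^ 2 - x ^ 2
    · have : Prod.mk x ⁻¹' {p : ℝ × ℝ | p.1 ^ 2 + p.2 ^ 2 ≤ R ^ 2 ∧ p.1 ∈ I} =
          Set.Icc (-√(R ^ 2 - x ^ 2)) (√(R ^ 2 - x ^ 2)) := by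
        ext y
        simp only [Set.mem_preimage, Set.mem_ofPred_eq, hx, and_true, Set.mem_Icc, ← abs_le]
        rw [Real.le_sqrt (abs_nonneg _) h0, sq_abs]
        constructor <;> intro h <;> linarith
      rw [this, Real.volume_Icc]
      ring_nf
    · have : Prod.mk x ⁻¹' {p : ℝ × ℝ | p.1 ^ 2 + p.2 ^ 2 ≤ R ^ 2 ∧ p.1 ∈ I} = ∅ := by
        ext y
        simp only [Set.mem_preimage, Set.mem_ofPred_eq, Set.mem_empty_iff_false, iff_false]
        rintro ⟨h, -⟩
        nlinarith [sq_nonneg y]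
      simp [this, Real.sqrt_eq_zero_of_nonpos (not_le.1 h0).le]
  · rw [Set.indicator_of_notMem hx]
    simp [hx]

/-- The sum of the two segments cut off by the radical axis is the closed form `exclusionArea`. -/
theorem segmentArea_add_segmentArea {d R₁ R₂ : ℝ} (hd : 0 < d) (h₁ : 0 < R₁) :
    segmentArea R₁ ((d ^ 2 + R₁ ^ 2 - R₂ ^ 2) / (2 * d)) +
      segmentArea R₂ ((d ^ 2 + R₂ ^ 2 - R₁ ^ 2) / (2 * d)) = exclusionArea d R₁ R₂ := by
  have hpow : R₂ ^ 2 - ((d ^ 2 + R₂ ^ 2 - R₁ ^ 2) / (2 * d)) ^ 2 =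
      R₁ ^ 2 - ((d ^ 2 + R₁ ^ 2 - R₂ ^ 2) / (2 * d)) ^ 2 := by
    field_simp
    ring
  have hsin : R₁ * √(1 - ((d ^ 2 + R₁ ^ 2 - R₂ ^ 2) / (2 * d * R₁)) ^ 2) =
      √(R₁ ^ 2 - ((d ^ 2 + R₁ ^ 2 - R₂ ^ 2) / (2 * d)) ^ 2) := by
    conv_lhs => rw [← Real.sqrt_sq h₁.le]
    rw [← Real.sqrt_mul (sq_nonneg _), Real.sqrt_sq h₁.le]
    congr 1
    field_simp
  have hsum : (d ^ 2 + R₁ ^ 2 - R₂ ^ 2) / (2 * d) + (d ^ 2 + R₂ ^ 2 - R₁ ^ 2) / (2 * d) = d := by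
    field_simp
    ring
  unfold segmentArea exclusionArea xi₁ xi₂
  rw [hpow, Real.sin_arccos, mul_assoc d R₁, hsin, div_div, div_div]
  linear_combination √(R₁ ^ 2 - ((d ^ 2 + R₁ ^ 2 - R₂ ^ 2) / (2 * d)) ^ 2) * hsum

/-- The radical axis of the two circles splits the union into two circular segments: on either side
of it, the union coincides with one of the disks. -/
theorem volume_closedBall_union_closedBall {d R₁ R₂ : ℝ} (hd : 0 < d) (h₁ : 0 < R₁)
    (h₂ : 0 < R₂) :
    volume (Metric.closedBall (0 : ℂ) R₁ ∪ Metric.closedBall (d : ℂ) R₂) =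
      ENNReal.ofReal (exclusionArea d R₁ R₂) := by
  set a := (d ^ 2 + R₁ ^ 2 - R₂ ^ 2) / (2 * d) with ha
  have hda : (d ^ 2 + R₂ ^ 2 - R₁ ^ 2) / (2 * d) = d - a := by
    rw [ha]; field_simp; ring
  have ha' : 2 * d * a = d ^ 2 + R₁ ^ 2 - R₂ ^ 2 := by rw [ha]; field_simp
  have hball : ∀ (c R : ℝ), 0 < R → ∀ z : ℂ,
      z ∈ Metric.closedBall (c : ℂ) R ↔ (z.re - c) ^ 2 + z.im ^ 2 ≤ R ^ 2 := by
    intro c R hR z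
    rw [mem_closedBall_iff_norm, ← abs_of_pos hR, ← sq_le_sq₀ (norm_nonneg _) (abs_nonneg _),
      sq_abs, Complex.sq_norm, Complex.normSq_apply]
    simp [← sq]
  have hsplit : Metric.closedBall (0 : ℂ) R₁ ∪ Metric.closedBall (d : ℂ) R₂ =
      (Metric.closedBall (0 : ℂ) R₁ ∩ Complex.re ⁻¹' Set.Iic a) ∪
        (Metric.closedBall (d : ℂ) R₂ ∩ Complex.re ⁻¹' Set.Ioi a) := by
    ext z
    have e₁ := hball 0 R₁ h₁ z
    have e₂ := hball d R₂ h₂ z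
    simp only [Complex.ofReal_zero] at e₁
    simp only [Set.mem_union, Set.mem_inter_iff, e₁, e₂, Set.mem_preimage, Set.mem_Iic,
      Set.mem_Ioi]
    rcases le_or_gt z.re a with hz | hz
    · have := not_lt.2 hz
      have : (z.re - d) ^ 2 + z.im ^ 2 ≤ R₂ ^ 2 → (z.re - 0) ^ 2 + z.im ^ 2 ≤ R₁ ^ 2 := by
        intro; nlinarith
      tauto
    · have := not_le.2 hz
      have : (z.re - 0) ^ 2 + z.im ^ 2 ≤ R₁ ^ 2 → (z.re - d) ^ 2 + z.im ^ 2 ≤ R₂ ^ 2 := by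
        intro; nlinarith
      tauto
  have hrefl : volume (Metric.closedBall (d : ℂ) R₂ ∩ Complex.re ⁻¹' Set.Ioi a) =
      volume (Metric.closedBall (0 : ℂ) R₂ ∩ Complex.re ⁻¹' Set.Iio (d - a)) := by
    rw [← (Measure.measurePreserving_sub_left volume (d : ℂ)).measure_preimage
      (measurableSet_closedBall.inter (Complex.measurable_re measurableSet_Ioi)).nullMeasurableSet]
    congr 1
    ext z
    simp [lt_sub_comm]
  rw [hsplit, measure_union (Set.disjoint_left.2 fun z hz hz' =>
      not_lt.2 (Set.mem_Iic.1 (Set.mem_preimage.1 hz.2))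
        (Set.mem_Ioi.1 (Set.mem_preimage.1 hz'.2)))
    (measurableSet_closedBall.inter (Complex.measurable_re measurableSet_Ioi)),
    hrefl, volume_segment h₁ a measurableSet_Iic (Filter.EventuallyEq.refl _ _),
    volume_segment h₂ (d - a) measurableSet_Iio Iio_ae_eq_Iic, ← ENNReal.ofReal_add
      (segmentArea_nonneg h₁ _) (segmentArea_nonneg h₂ _), ← hda, ha,
    segmentArea_add_segmentArea hd h₁]

theorem measurableSet_exclusionRegion (d R₁ R₂ : ℝ) (x : Plane) (t : ℝ) :
    MeasurableSet (exclusionRegion d R₁ R₂ x t) :=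
  measurableSet_closedBall.union measurableSet_closedBall

/-- Multiplication by `exp (t * I)` followed by the identification of `ℂ` with the plane carries
the model configuration to the exclusion region. -/
theorem volume_exclusionRegion {d R₁ R₂ : ℝ} (hd : 0 < d) (h₁ : 0 < R₁) (h₂ : 0 < R₂)
    (x : Plane) (t : ℝ) :
    volume (exclusionRegion d R₁ R₂ x t) = ENNReal.ofReal (exclusionArea d R₁ R₂) := by
  let f : ℂ ≃ₗᵢ[ℝ] Plane := (rotation (Circle.exp t)).trans Complex.orthonormalBasisOneI.repr
  have hf : f (d : ℂ) = !₂[d * Real.cos t, d * Real.sin t] := by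
    have h : f (d : ℂ) = Complex.orthonormalBasisOneI.repr (Circle.exp t * (d : ℂ)) := rfl
    ext i
    rw [h, Complex.orthonormalBasisOneI_repr_apply]
    fin_cases i <;> simp [Circle.coe_exp, Complex.exp_ofReal_mul_I_re,
      Complex.exp_ofReal_mul_I_im, mul_comm d]
  have hmem : ∀ (c z : ℂ) (R : ℝ), x + f z ∈ Metric.closedBall (x + f c) R ↔
      z ∈ Metric.closedBall c R := by
    intro c z R
    rw [Metric.mem_closedBall, dist_add_left, f.dist_map, Metric.mem_closedBall]
  have hpre : f ⁻¹' ((x + ·) ⁻¹' exclusionRegion d R₁ R₂ x t) =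
      Metric.closedBall (0 : ℂ) R₁ ∪ Metric.closedBall (d : ℂ) R₂ := by
    ext z
    have e₁ := hmem 0 z R₁
    have e₂ := hmem d z R₂
    rw [map_zero, add_zero] at e₁
    rw [hf] at e₂
    simp only [exclusionRegion, receiver, Set.mem_preimage, Set.mem_union, e₁, e₂]
  rw [← volume_closedBall_union_closedBall hd h₁ h₂, ← hpre,
    f.measurePreserving.measure_preimage (measurable_const_add x
      (measurableSet_exclusionRegion d R₁ R₂ x t)).nullMeasurableSet, measure_preimage_add]

theorem exclusionArea_nonneg {d R₁ R₂ : ℝ} (hd : 0 < d) (h₁ : 0 < R₁) (h₂ : 0 < R₂) :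
    0 ≤ exclusionArea d R₁ R₂ := by
  rw [← segmentArea_add_segmentArea hd h₁]
  exact add_nonneg (segmentArea_nonneg h₁ _) (segmentArea_nonneg h₂ _)

theorem continuousAt_exclusionArea {d R₁ R₂ : ℝ} (hd : 0 < d) (h₁ : 0 < R₁) (h₂ : 0 < R₂) :
    ContinuousAt (fun ε => exclusionArea d (R₁ + ε) (R₂ + ε)) 0 := by
  unfold exclusionArea xi₁ xi₂
  have : 2 * d * (R₁ + 0) ≠ 0 := by positivity
  have : 2 * d * (R₂ + 0) ≠ 0 := by positivity
  fun_prop (disch := assumption)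

/-! ### Isolated points of a Poisson process -/

section

variable {Ω : Type*} [MeasurableSpace Ω] {P : Measure Ω}

/-- The factors `exp (-lam * |C|)` and `exp (-lam * |D \ C|)` merge, so that the probability depends
on `C` only through the factor `|C|`, which is additive over cells. -/
theorem IsPoissonProcess.measure_encard_eq_one_inter_encard_eq_zero {Φ : Ω → Set Plane} {lam : ℝ}
    (h : IsPoissonProcess P Φ lam) (hlam : 0 ≤ lam) {C D : Set Plane} (hC : MeasurableSet C)
    (hD : MeasurableSet D) (hCD : C ⊆ D) (hDfin : volume D < ∞) :
    P ({ω | (Φ ω ∩ C).encard = 1} ∩ {ω | (Φ ω ∩ (D \ C)).encard = 0}) =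
      ENNReal.ofReal lam * volume C * ENNReal.ofReal (Real.exp (-(lam * (volume D).toReal))) := by
  have hCfin : volume C < ∞ := (measure_mono hCD).trans_lt hDfin
  have hDCfin : volume (D \ C) < ∞ := (measure_mono Set.sdiff_subset).trans_lt hDfin
  have hind := (h.indep_count 2 ![C, D \ C]
    (by intro i; fin_cases i <;> simp [hC, hD.diff hC])
    (by
      intro i j hij
      fin_cases i <;> fin_cases j <;>
        simp_all [Set.disjoint_sdiff_right, Set.disjoint_sdiff_left])).indepFun
    (show (0 : Fin 2) ≠ 1 by decide)
  have hmul := hind.measure_inter_preimage_eq_mul {1} {0} (measurableSet_singleton _)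
    (measurableSet_singleton _)
  have h1 := h.poisson_count C hC hCfin 1
  have h0 := h.poisson_count (D \ C) (hD.diff hC) hDCfin 0
  have hvol : (volume D).toReal = (volume C).toReal + (volume (D \ C)).toReal := by
    rw [← ENNReal.toReal_add hCfin.ne hDCfin.ne, measure_add_sdiff hC.nullMeasurableSet,
      Set.union_eq_self_of_subset_left hCD]
  have hnn : ∀ B : Set Plane, 0 ≤ lam * (volume B).toReal := fun B => by positivity
  rw [poissonMeasure_singleton, Real.coe_toNNReal _ (hnn _)] at h1 h0
  calc P ({ω | (Φ ω ∩ C).encard = 1} ∩ {ω | (Φ ω ∩ (D \ C)).encard = 0})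
      = P {ω | (Φ ω ∩ C).encard = (1 : ℕ)} * P {ω | (Φ ω ∩ (D \ C)).encard = (0 : ℕ)} := hmul
    _ = _ := by
      rw [h1, h0, ← ENNReal.ofReal_mul (by have := hnn C; positivity),
        ← ENNReal.ofReal_toReal hCfin.ne, ← ENNReal.ofReal_mul hlam,
        ← ENNReal.ofReal_mul (by have := hnn C; positivity), ENNReal.toReal_ofReal (by positivity),
        hvol, mul_add, neg_add, Real.exp_add]
      congr 1
      simp
      ring

/-- The plane is a countable disjoint union of Borel cells of arbitrarily small diameter: the
fibers of a measurable map to a countable type. -/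
theorem exists_measurable_dist_le_of_eq {ε : ℝ} (hε : 0 < ε) :
    ∃ g : Plane → ℤ × ℤ, Measurable g ∧ ∀ x y, g x = g y → dist x y ≤ ε := by
  refine ⟨fun x => (⌊x 0 * (2 / ε)⌋, ⌊x 1 * (2 / ε)⌋), by fun_prop, fun x y hxy => ?_⟩
  have hcoord : ∀ a b : ℝ, ⌊a * (2 / ε)⌋ = ⌊b * (2 / ε)⌋ → |a - b| ≤ ε / 2 := by
    intro a b hab
    have h := (Int.abs_sub_lt_one_of_floor_eq_floor hab).le
    rw [← sub_mul, abs_mul, abs_of_pos (by positivity : 0 < 2 / ε), ← le_div_iff₀ (by positivity)]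
      at h
    simpa using h
  obtain ⟨h0, h1⟩ := Prod.ext_iff.1 hxy
  have h0 := hcoord _ _ h0
  have h1 := hcoord _ _ h1
  rw [EuclideanSpace.dist_eq, Fin.sum_univ_two, Real.dist_eq, Real.dist_eq]
  refine Real.sqrt_le_iff.2 ⟨hε.le, ?_⟩
  have := pow_le_pow_left₀ (abs_nonneg _) h0 2
  have := pow_le_pow_left₀ (abs_nonneg _) h1 2
  nlinarith [sq_nonneg ε]

/-- The inner as well as the outer bound on the exclusion regions of a cell is an instance of this
inclusion, with `x` and `y` exchanged. -/
theorem exclusionRegion_subset_exclusionRegion_add {d R₁ R₂ ε : ℝ} {x y : Plane}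
    (h : dist x y ≤ ε) (t : ℝ) :
    exclusionRegion d R₁ R₂ x t ⊆ exclusionRegion d (R₁ + ε) (R₂ + ε) y t := by
  refine Set.union_subset_union (Metric.closedBall_subset_closedBall' (by linarith))
    (Metric.closedBall_subset_closedBall' ?_)
  rw [receiver, receiver, dist_add_right]
  linarith

/-- The event that the `i`-th point lies in `B` and is the only one in its exclusion region, when
its orientation is `t`. -/
def isolatedEvent (X : ℕ → Ω → Plane) (d R₁ R₂ : ℝ) (B : Set Plane) (t : ℝ) (i : ℕ) : Set Ω :=
  {ω | X i ω ∈ B ∧ ∀ j, j ≠ i → X j ω ∉ exclusionRegion d R₁ R₂ (X i ω) t}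

/-- Joint measurability in locations and orientation, as needed for Fubini. -/
theorem measurableSet_isolated_prod {d R₁ R₂ : ℝ} {B : Set Plane} (hB : MeasurableSet B) (i : ℕ) :
    MeasurableSet {p : (ℕ → Plane) × ℝ |
      p.1 i ∈ B ∧ ∀ j, j ≠ i → p.1 j ∉ exclusionRegion d R₁ R₂ (p.1 i) p.2} := by
  have hj : ∀ j, MeasurableSet
      {p : (ℕ → Plane) × ℝ | p.1 j ∈ exclusionRegion d R₁ R₂ (p.1 i) p.2} := by
    intro j
    unfold exclusionRegion receiver
    simp only [Set.mem_union, Metric.mem_closedBall]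
    measurability
  have hall : MeasurableSet {p : (ℕ → Plane) × ℝ |
      ∀ j, j ≠ i → p.1 j ∉ exclusionRegion d R₁ R₂ (p.1 i) p.2} := by
    simp only [Set.ofPred_forall]
    exact MeasurableSet.iInter fun j => MeasurableSet.iInter fun _ => (hj j).compl
  exact (measurableSet_preimage (f := fun p : (ℕ → Plane) × ℝ => p.1 i) (by fun_prop) hB).inter
    hall

theorem measurableSet_isolatedEvent {X : ℕ → Ω → Plane} (hX : ∀ i, Measurable (X i))
    {d R₁ R₂ : ℝ} {B : Set Plane} (hB : MeasurableSet B) (t : ℝ) (i : ℕ) :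
    MeasurableSet (isolatedEvent X d R₁ R₂ B t i) :=
  measurableSet_preimage (f := fun ω => ((fun i => X i ω), t)) (by fun_prop)
    (measurableSet_isolated_prod hB i)

/-- If `D` contains the exclusion region of every point of `C`, then a point of `C` that is alone in
`D` is isolated. -/
theorem measure_le_tsum_isolatedEvent {X : ℕ → Ω → Plane}
    (hinj : ∀ᵐ ω ∂P, Function.Injective (fun i => X i ω)) {d R₁ R₂ t : ℝ} {C D : Set Plane}
    (h : ∀ p ∈ C, exclusionRegion d R₁ R₂ p t ⊆ D) :
    P ({ω | (pointSet X ω ∩ C).encard = 1} ∩ {ω | (pointSet X ω ∩ (D \ C)).encard = 0}) ≤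
      ∑' i, P (isolatedEvent X d R₁ R₂ C t i) := by
  refine (measure_mono_ae ?_).trans (measure_iUnion_le _)
  filter_upwards [hinj] with ω hω hG
  obtain ⟨h1, h0⟩ := hG
  obtain ⟨p, hp⟩ := Set.encard_eq_one.1 h1
  obtain ⟨⟨i, hi⟩, hpC⟩ : p ∈ pointSet X ω ∩ C := hp ▸ Set.mem_singleton p
  have hi' : X i ω = p := hi
  refine Set.mem_iUnion.2 ⟨i, by rwa [hi'], fun j hj hjA => ?_⟩
  rw [hi'] at hjA
  have hjC : X j ω ∉ C := fun hjC => hj (hω (by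
    have : X j ω ∈ ({p} : Set Plane) := hp ▸ ⟨⟨j, rfl⟩, hjC⟩
    exact (Set.mem_singleton_iff.1 this).trans hi'.symm))
  exact (Set.encard_eq_zero.1 h0).le (show X j ω ∈ _ from ⟨⟨j, rfl⟩, h p hpC hjA, hjC⟩)

/-- If `D` contains `C` and is contained in the exclusion region of every point of `C`, then at most
one point of `C` is isolated, and it is alone in `D`. -/
theorem tsum_isolatedEvent_le_measure {X : ℕ → Ω → Plane} (hX : ∀ i, Measurable (X i))
    {d R₁ R₂ t : ℝ} {C D : Set Plane} (hC : MeasurableSet C) (hCD : C ⊆ D)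
    (h : ∀ p ∈ C, D ⊆ exclusionRegion d R₁ R₂ p t) :
    ∑' i, P (isolatedEvent X d R₁ R₂ C t i) ≤
      P ({ω | (pointSet X ω ∩ C).encard = 1} ∩ {ω | (pointSet X ω ∩ (D \ C)).encard = 0}) := by
  rw [← measure_iUnion (fun i j hij => Set.disjoint_left.2 fun ω hi hj =>
    hi.2 j hij.symm (h _ hi.1 (hCD hj.1))) (measurableSet_isolatedEvent hX hC t)]
  refine measure_mono (Set.iUnion_subset fun i ω hi => ⟨?_, ?_⟩)
  · refine Set.encard_eq_one.2 ⟨X i ω, Set.eq_singleton_iff_unique_mem.2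
      ⟨⟨⟨i, rfl⟩, hi.1⟩, ?_⟩⟩
    rintro _ ⟨⟨j, rfl⟩, hj⟩
    by_contra hne
    exact hi.2 j (fun hji => hne (by rw [hji])) (h _ hi.1 (hCD hj))
  · refine Set.encard_eq_zero.2 (Set.eq_empty_of_forall_notMem ?_)
    rintro _ ⟨⟨j, rfl⟩, hjD, hjC⟩
    exact hi.2 j (fun hji => hjC (by rw [hji]; exact hi.1)) (h _ hi.1 hjD)

theorem tsum_isolatedEvent_eq_tsum_cells {X : ℕ → Ω → Plane} (hX : ∀ i, Measurable (X i))
    {d R₁ R₂ t : ℝ} {B : Set Plane} (hB : MeasurableSet B) {κ : Type*} [Countable κ]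
    [MeasurableSpace κ] [MeasurableSingletonClass κ] {g : Plane → κ} (hg : Measurable g) :
    ∑' i, P (isolatedEvent X d R₁ R₂ B t i) =
      ∑' k, ∑' i, P (isolatedEvent X d R₁ R₂ (B ∩ g ⁻¹' {k}) t i) := by
  rw [ENNReal.tsum_comm]
  refine tsum_congr fun i => ?_
  rw [← measure_iUnion (fun k l hkl => Set.disjoint_left.2 fun ω hk hl =>
    hkl (hk.1.2.symm.trans hl.1.2)) fun k => measurableSet_isolatedEvent hX
      (hB.inter (hg (measurableSet_singleton k))) t i]
  congr 1
  ext ω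
  simp [isolatedEvent]

theorem tsum_volume_cells {B : Set Plane} (hB : MeasurableSet B) {κ : Type*} [Countable κ]
    [MeasurableSpace κ] [MeasurableSingletonClass κ] {g : Plane → κ} (hg : Measurable g) :
    ∑' k, volume (B ∩ g ⁻¹' {k}) = volume B := by
  rw [← measure_iUnion (fun k l hkl => Set.disjoint_left.2 fun ω hk hl =>
    hkl (hk.2.symm.trans hl.2)) fun k => hB.inter (hg (measurableSet_singleton k))]
  congr 1
  ext x
  simp

/-- In each cell `C` with reference point `c`, the set `D` is the region of `c` with radii enlarged
by `ε`. -/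
theorem le_tsum_isolatedEvent {X : ℕ → Ω → Plane} {lam d R₁ R₂ ε : ℝ}
    (hX : ∀ i, Measurable (X i)) (hinj : ∀ᵐ ω ∂P, Function.Injective (fun i => X i ω))
    (hpois : IsPoissonProcess P (pointSet X) lam) (hlam : 0 ≤ lam) (hd : 0 < d) (h₁ : 0 < R₁)
    (h₂ : 0 < R₂) (hε : 0 < ε) {B : Set Plane} (hB : MeasurableSet B) (t : ℝ) :
    ENNReal.ofReal lam * volume B *
        ENNReal.ofReal (Real.exp (-(lam * exclusionArea d (R₁ + ε) (R₂ + ε)))) ≤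
      ∑' i, P (isolatedEvent X d R₁ R₂ B t i) := by
  obtain ⟨g, hg, hdist⟩ := exists_measurable_dist_le_of_eq hε
  rw [tsum_isolatedEvent_eq_tsum_cells hX hB hg, ← tsum_volume_cells hB hg,
    ← ENNReal.tsum_mul_left, ← ENNReal.tsum_mul_right]
  refine ENNReal.tsum_le_tsum fun k => ?_
  rcases (B ∩ g ⁻¹' {k}).eq_empty_or_nonempty with he | ⟨c, hc⟩
  · simp [he]
  have hball : ∀ p ∈ B ∩ g ⁻¹' {k}, dist p c ≤ ε := fun p hp =>
    hdist p c (hp.2.trans hc.2.symm)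
  have hvol := volume_exclusionRegion hd (by linarith : 0 < R₁ + ε) (by linarith : 0 < R₂ + ε) c t
  rw [← ENNReal.toReal_ofReal (exclusionArea_nonneg hd (by linarith : 0 < R₁ + ε)
    (by linarith : 0 < R₂ + ε)), ← hvol,
    ← hpois.measure_encard_eq_one_inter_encard_eq_zero hlam
      (hB.inter (hg (measurableSet_singleton k))) (measurableSet_exclusionRegion _ _ _ c t)
      (fun p hp => Or.inl ((hball p hp).trans (by linarith))) (by simp [hvol])]
  exact measure_le_tsum_isolatedEvent hinj fun p hp =>
    exclusionRegion_subset_exclusionRegion_add (hball p hp) t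

/-- In each cell `C` with reference point `c`, the set `D` is the region of `c` with radii reduced
by `ε`. -/
theorem tsum_isolatedEvent_le {X : ℕ → Ω → Plane} {lam d R₁ R₂ ε : ℝ}
    (hX : ∀ i, Measurable (X i))
    (hpois : IsPoissonProcess P (pointSet X) lam) (hlam : 0 ≤ lam) (hd : 0 < d)
    (hε : 0 < ε) (h₁ : 2 * ε ≤ R₁) (h₂ : 2 * ε ≤ R₂) {B : Set Plane} (hB : MeasurableSet B)
    (t : ℝ) :
    ∑' i, P (isolatedEvent X d R₁ R₂ B t i) ≤ ENNReal.ofReal lam * volume B *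
        ENNReal.ofReal (Real.exp (-(lam * exclusionArea d (R₁ + -ε) (R₂ + -ε)))) := by
  obtain ⟨g, hg, hdist⟩ := exists_measurable_dist_le_of_eq hε
  rw [tsum_isolatedEvent_eq_tsum_cells hX hB hg, ← tsum_volume_cells hB hg,
    ← ENNReal.tsum_mul_left, ← ENNReal.tsum_mul_right]
  refine ENNReal.tsum_le_tsum fun k => ?_
  rcases (B ∩ g ⁻¹' {k}).eq_empty_or_nonempty with he | ⟨c, hc⟩
  · simp [he, isolatedEvent]
  have hball : ∀ p ∈ B ∩ g ⁻¹' {k}, dist p c ≤ ε := fun p hp =>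
    hdist p c (hp.2.trans hc.2.symm)
  have hvol := volume_exclusionRegion hd (by linarith : 0 < R₁ + -ε)
    (by linarith : 0 < R₂ + -ε) c t
  -- The cell is small enough to lie in the shrunken region.
  have hsub : B ∩ g ⁻¹' {k} ⊆ exclusionRegion d (R₁ + -ε) (R₂ + -ε) c t := fun p hp =>
    Or.inl ((hball p hp).trans (by linarith))
  rw [← ENNReal.toReal_ofReal (exclusionArea_nonneg hd (by linarith : 0 < R₁ + -ε)
    (by linarith : 0 < R₂ + -ε)), ← hvol,
    ← hpois.measure_encard_eq_one_inter_encard_eq_zero hlam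
      (hB.inter (hg (measurableSet_singleton k))) (measurableSet_exclusionRegion _ _ _ c t)
      hsub (by simp [hvol])]
  refine tsum_isolatedEvent_le_measure hX (hB.inter (hg (measurableSet_singleton k))) hsub
    fun p hp => ?_
  have := exclusionRegion_subset_exclusionRegion_add (d := d) (R₁ := R₁ + -ε) (R₂ := R₂ + -ε)
    ((dist_comm c p).trans_le (hball p hp)) t
  simpa using this

/-- The expected number of isolated points of `B`, for a fixed orientation `t`. The bounds for cells
of diameter at most `ε` coincide in the limit `ε → 0`. -/
theorem tsum_isolatedEvent {X : ℕ → Ω → Plane} {lam d R₁ R₂ : ℝ}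
    (hX : ∀ i, Measurable (X i)) (hinj : ∀ᵐ ω ∂P, Function.Injective (fun i => X i ω))
    (hpois : IsPoissonProcess P (pointSet X) lam) (hlam : 0 ≤ lam) (hd : 0 < d) (h₁ : 0 < R₁)
    (h₂ : 0 < R₂) {B : Set Plane} (hB : MeasurableSet B) (t : ℝ) :
    ∑' i, P (isolatedEvent X d R₁ R₂ B t i) = ENNReal.ofReal lam * volume B *
      ENNReal.ofReal (Real.exp (-(lam * exclusionArea d R₁ R₂))) := by
  have hlim : Filter.Tendsto (fun ε => ENNReal.ofReal lam * volume B *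
      ENNReal.ofReal (Real.exp (-(lam * exclusionArea d (R₁ + ε) (R₂ + ε))))) (nhds 0)
      (nhds (ENNReal.ofReal lam * volume B *
        ENNReal.ofReal (Real.exp (-(lam * exclusionArea d R₁ R₂))))) := by
    have hc : ContinuousAt (fun ε => Real.exp (-(lam * exclusionArea d (R₁ + ε) (R₂ + ε)))) 0 :=
      Real.continuous_exp.continuousAt.comp
        ((continuousAt_exclusionArea hd h₁ h₂).const_mul lam).neg
    have hc' := ENNReal.tendsto_ofReal hc.tendsto
    simp only [add_zero] at hc'
    exact ENNReal.Tendsto.const_mul hc' (Or.inl (by simp [Real.exp_pos]))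
  have hneg : Filter.Tendsto (fun ε : ℝ => -ε) (nhdsWithin 0 (Set.Ioi 0)) (nhds 0) := by
    simpa using (continuous_neg (G := ℝ)).continuousAt.tendsto.mono_left
      (nhdsWithin_le_nhds (a := (0 : ℝ)) (s := Set.Ioi 0))
  refine le_antisymm (ge_of_tendsto (hlim.comp hneg) ?_)
    (le_of_tendsto (hlim.mono_left (nhdsWithin_le_nhds (s := Set.Ioi 0))) ?_)
  · filter_upwards [Ioc_mem_nhdsGT (show (0 : ℝ) < min R₁ R₂ / 2 by positivity)] with ε hε
    have := min_le_left R₁ R₂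
    have := min_le_right R₁ R₂
    exact tsum_isolatedEvent_le hX hpois hlam hd hε.1 (by linarith [hε.2]) (by linarith [hε.2])
      hB t
  · filter_upwards [self_mem_nhdsWithin] with ε hε
    exact le_tsum_isolatedEvent hX hinj hpois hlam hd h₁ h₂ hε hB t

end

/-! ### Active transmitters of the bipolar model -/

theorem mem_activeTransmitters {d R₁ R₂ : ℝ} {ψ : MarkedPattern} {y : Plane} :
    y ∈ activeTransmitters d R₁ R₂ ψ ↔
      ∃ s, (y, s) ∈ ψ ∧ ∀ q ∈ ψ, q.1 ∈ exclusionRegion d R₁ R₂ y s → q = (y, s) := by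
  have hacc : ∀ p, accessIndicator d R₁ R₂ ψ p = 1 ↔
      ∀ q ∈ ψ, q.1 ∈ exclusionRegion d R₁ R₂ p.1 p.2 → q = p := by
    intro p
    have h : accessIndicator d R₁ R₂ ψ p = 1 ↔ (neighborhood d R₁ R₂ ψ p).encard = 0 := by
      unfold accessIndicator
      split_ifs with h0 <;> simp [h0]
    simp only [h, Set.encard_eq_zero, Set.eq_empty_iff_forall_notMem, neighborhood,
      Set.mem_ofPred_eq, not_and, not_not]
  constructor
  · rintro ⟨⟨y, s⟩, ⟨hψ, h⟩, rfl⟩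
    exact ⟨s, hψ, (hacc _).1 h⟩
  · rintro ⟨s, hψ, h⟩
    exact ⟨(y, s), ⟨hψ, (hacc _).2 h⟩, rfl⟩

theorem mem_activeTransmitters_markedSet {Ω : Type*} {X : ℕ → Ω → Plane} {θ : ℕ → Ω → ℝ}
    {d R₁ R₂ : ℝ} {ω : Ω} (hinj : Function.Injective (fun i => X i ω)) (i : ℕ) :
    X i ω ∈ activeTransmitters d R₁ R₂ (markedSet X θ ω) ↔
      ∀ j, j ≠ i → X j ω ∉ exclusionRegion d R₁ R₂ (X i ω) (θ i ω) := by
  rw [mem_activeTransmitters]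
  constructor
  · rintro ⟨s, ⟨k, hk⟩, h⟩ j hj hmem
    obtain ⟨hk1, hk2⟩ := Prod.ext_iff.1 hk
    obtain rfl : k = i := hinj hk1
    obtain rfl : θ k ω = s := hk2
    exact hj (hinj (congrArg Prod.fst (h _ ⟨j, rfl⟩ hmem)))
  · intro h
    refine ⟨θ i ω, ⟨i, rfl⟩, ?_⟩
    rintro _ ⟨j, rfl⟩ hmem
    obtain rfl : j = i := by
      by_contra hj
      exact h j hj hmem
    rfl

theorem activeTransmitters_subset (d R₁ R₂ : ℝ) (ψ : MarkedPattern) :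
    activeTransmitters d R₁ R₂ ψ ⊆ Prod.fst '' ψ :=
  Set.image_mono fun _ hp => hp.1

theorem sub_mem_exclusionRegion_sub {d R₁ R₂ : ℝ} {p y x : Plane} {s : ℝ} :
    p - x ∈ exclusionRegion d R₁ R₂ (y - x) s ↔ p ∈ exclusionRegion d R₁ R₂ y s := by
  have : receiver d (y - x) s = receiver d y s - x := by simp only [receiver]; abel
  simp only [exclusionRegion, this, Set.mem_union, Metric.mem_closedBall, dist_sub_right]

/-- Thinning commutes with translations. -/
theorem zero_mem_activeTransmitters_shift {d R₁ R₂ : ℝ} {ψ : MarkedPattern} {x : Plane} :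
    (0 : Plane) ∈ activeTransmitters d R₁ R₂ (shift ψ x) ↔ x ∈ activeTransmitters d R₁ R₂ ψ := by
  have hinj : ∀ (q : Plane × ℝ) (s : ℝ), (q.1 - x, q.2) = ((0 : Plane), s) ↔ q = (x, s) := by
    rintro ⟨p, r⟩ s
    simp [sub_eq_zero]
  have hmem : ∀ s, ((0 : Plane), s) ∈ shift ψ x ↔ (x, s) ∈ ψ := by
    intro s
    simp only [shift, Set.mem_image, hinj, exists_eq_right]
  rw [mem_activeTransmitters, mem_activeTransmitters]
  refine exists_congr fun s => and_congr (hmem s) ?_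
  simp only [shift, Set.forall_mem_image, hinj]
  refine forall₂_congr fun q _ => ?_
  rw [← sub_mem_exclusionRegion_sub (y := x) (x := x), sub_self]

theorem tsum_indicator_shift_eq_encard {d R₁ R₂ : ℝ} (ψ : MarkedPattern) (B : Set Plane) :
    ∑' x : ↥(Prod.fst '' ψ ∩ B), {ψ | (0 : Plane) ∈ activeTransmitters d R₁ R₂ ψ}.indicator
        (fun _ => (1 : ℝ≥0∞)) (shift ψ x) =
      (((activeTransmitters d R₁ R₂ ψ ∩ B).encard : ℕ∞) : ℝ≥0∞) := by
  classical
  rw [← ENNReal.tsum_set_one, tsum_subtype (activeTransmitters d R₁ R₂ ψ ∩ B)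
      (fun _ => (1 : ℝ≥0∞)),
    tsum_subtype (Prod.fst '' ψ ∩ B) (fun x : Plane =>
      {ψ | (0 : Plane) ∈ activeTransmitters d R₁ R₂ ψ}.indicator (fun _ => (1 : ℝ≥0∞))
        (shift ψ x))]
  refine tsum_congr fun x => ?_
  have hsub := @activeTransmitters_subset d R₁ R₂ ψ x
  have hshift := @zero_mem_activeTransmitters_shift d R₁ R₂ ψ x
  simp only [Set.indicator_apply, Set.mem_inter_iff, Set.mem_ofPred_eq, hshift, ← ite_and]
  refine if_congr ?_ rfl rfl
  tauto

theorem encard_range_inter {ι α : Type*} {f : ι → α} (hf : Function.Injective f) (S : Set α) :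
    (((Set.range f ∩ S).encard : ℕ∞) : ℝ≥0∞) = ∑' i, S.indicator (fun _ => 1) (f i) := by
  rw [← Set.image_preimage_eq_range_inter, hf.encard_image, ← ENNReal.tsum_set_one,
    tsum_subtype (f ⁻¹' S) (fun _ => (1 : ℝ≥0∞))]
  rfl

section

variable {Ω : Type*} [MeasurableSpace Ω] {P : Measure Ω} [IsProbabilityMeasure P]
  {X : ℕ → Ω → Plane} {θ : ℕ → Ω → ℝ} {lam d R₁ R₂ : ℝ}

/-- As the orientation is independent of the locations, it can be frozen: the probability that the
`i`-th point is in `B` and active is an average over the orientation. -/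
theorem IsPoissonBipolar.measure_active_eq_lintegral (h : IsPoissonBipolar P X θ lam)
    {B : Set Plane} (hB : MeasurableSet B) (i : ℕ) :
    P {ω | X i ω ∈ B ∧ ∀ j, j ≠ i → X j ω ∉ exclusionRegion d R₁ R₂ (X i ω) (θ i ω)} =
      ∫⁻ t, P (isolatedEvent X d R₁ R₂ B t i) ∂(P.map (θ 0)) := by
  have hX : Measurable fun (ω : Ω) (i : ℕ) => X i ω := measurable_pi_lambda _ h.measurable_location
  have hθ := h.measurable_orientation
  have hind : IndepFun (fun (ω : Ω) (i : ℕ) => X i ω) (θ i) P :=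
    h.indep_location.comp measurable_id (measurable_pi_apply i)
  have hlaw : P.map (θ i) = P.map (θ 0) := (h.uniform i).trans (h.uniform 0).symm
  have hS := measurableSet_isolated_prod (d := d) (R₁ := R₁) (R₂ := R₂) hB i
  have : IsProbabilityMeasure (P.map (θ i)) := Measure.isProbabilityMeasure_map (hθ i).aemeasurable
  have : IsProbabilityMeasure (P.map fun (ω : Ω) (i : ℕ) => X i ω) :=
    Measure.isProbabilityMeasure_map hX.aemeasurable
  have hprod := (indepFun_iff_map_prod_eq_prod_map_map hX.aemeasurable (hθ i).aemeasurable).1 hind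
  have h1 := Measure.map_apply (μ := P) (hX.prodMk (hθ i)) hS
  rw [hprod, Measure.prod_apply_symm hS] at h1
  rw [← hlaw]
  refine h1.symm.trans (lintegral_congr fun t => ?_)
  rw [Measure.map_apply hX (measurable_prodMk_right hS)]
  rfl

theorem measurable_measure_isolatedEvent (hX : ∀ i, Measurable (X i)) {B : Set Plane}
    (hB : MeasurableSet B) (i : ℕ) :
    Measurable fun t => P (isolatedEvent X d R₁ R₂ B t i) := by
  have hS := measurableSet_isolated_prod (d := d) (R₁ := R₁) (R₂ := R₂) hB i
  have hf : Measurable fun p : Ω × ℝ => ((fun i => X i p.1 : ℕ → Plane), p.2) := by fun_prop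
  exact measurable_measure_prodMk_right (hf hS)

theorem IsPoissonBipolar.hasIntensity (h : IsPoissonBipolar P X θ lam) (hlam : 0 ≤ lam)
    (hd : 0 < d) (h₁ : 0 < R₁) (h₂ : 0 < R₂) :
    HasIntensity P (fun ω => activeTransmitters d R₁ R₂ (markedSet X θ ω))
      (ENNReal.ofReal (lam * Real.exp (-(lam * exclusionArea d R₁ R₂)))) := by
  intro B hB
  set E : ℕ → Set Ω := fun i =>
    {ω | X i ω ∈ B ∧ ∀ j, j ≠ i → X j ω ∉ exclusionRegion d R₁ R₂ (X i ω) (θ i ω)} with hE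
  have hEmeas : ∀ i, MeasurableSet (E i) := fun i =>
    measurableSet_preimage (f := fun ω => ((fun i => X i ω), θ i ω))
      (by have := h.measurable_location; have := h.measurable_orientation; fun_prop)
      (measurableSet_isolated_prod hB i)
  have hcount : ∀ᵐ ω ∂P,
      (((activeTransmitters d R₁ R₂ (markedSet X θ ω) ∩ B).encard : ℕ∞) : ℝ≥0∞) =
        ∑' i, (E i).indicator (fun _ => 1) ω := by
    filter_upwards [h.injective] with ω hω
    have hsub : activeTransmitters d R₁ R₂ (markedSet X θ ω) ∩ B =
        Set.range (fun i => X i ω) ∩ (activeTransmitters d R₁ R₂ (markedSet X θ ω) ∩ B) := by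
      refine (Set.inter_eq_right.2 fun x hx => ?_).symm
      obtain ⟨_, ⟨i, rfl⟩, rfl⟩ := activeTransmitters_subset _ _ _ _ hx.1
      exact ⟨i, rfl⟩
    rw [hsub, encard_range_inter hω]
    refine tsum_congr fun i => ?_
    classical
    simp only [Set.indicator_apply]
    refine if_congr ?_ rfl rfl
    rw [Set.mem_inter_iff, mem_activeTransmitters_markedSet hω, and_comm]
    rfl
  have hprob : IsProbabilityMeasure (P.map (θ 0)) :=
    Measure.isProbabilityMeasure_map (h.measurable_orientation 0).aemeasurable
  rw [lintegral_congr_ae hcount,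
    lintegral_tsum fun i => (measurable_const.indicator (hEmeas i)).aemeasurable]
  calc ∑' i, ∫⁻ ω, (E i).indicator (fun _ => 1) ω ∂P
      = ∑' i, ∫⁻ t, P (isolatedEvent X d R₁ R₂ B t i) ∂(P.map (θ 0)) :=
        tsum_congr fun i => by
          rw [lintegral_indicator_const (hEmeas i), one_mul, h.measure_active_eq_lintegral hB i]
    _ = ∫⁻ t, ∑' i, P (isolatedEvent X d R₁ R₂ B t i) ∂(P.map (θ 0)) :=
        (lintegral_tsum fun i =>
          (measurable_measure_isolatedEvent h.measurable_location hB i).aemeasurable).symm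
    _ = ENNReal.ofReal (lam * Real.exp (-(lam * exclusionArea d R₁ R₂))) * volume B := by
        simp only [tsum_isolatedEvent h.measurable_location h.injective h.poisson hlam hd h₁ h₂ hB,
          lintegral_const, measure_univ, mul_one]
        rw [ENNReal.ofReal_mul hlam, mul_right_comm]

/-- Translating the typical point to the origin turns the Palm sum into the number of active
transmitters in the window, so that the Palm probability is a ratio of intensities. -/
theorem IsPoissonBipolar.palmProb_eq (h : IsPoissonBipolar P X θ lam) (hlam : 0 < lam)
    (hd : 0 < d) (h₁ : 0 < R₁) (h₂ : 0 < R₂) {B : Set Plane} (hB : MeasurableSet B)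
    (hpos : 0 < volume B) (hfin : volume B < ∞) :
    palmProb P (markedSet X θ) lam B {ψ | (0 : Plane) ∈ activeTransmitters d R₁ R₂ ψ} =
      ENNReal.ofReal (Real.exp (-(lam * exclusionArea d R₁ R₂))) := by
  simp only [palmProb, tsum_indicator_shift_eq_encard]
  rw [h.hasIntensity hlam.le hd h₁ h₂ B hB, ENNReal.ofReal_mul hlam.le, mul_right_comm, mul_comm]
  exact ENNReal.mul_div_cancel_right
    (mul_ne_zero (ENNReal.ofReal_pos.2 hlam).ne' hpos.ne')
    (ENNReal.mul_ne_top ENNReal.ofReal_ne_top hfin.ne)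

end

end DualZone

theorem mainTheorem3 {Ω : Type*} [MeasurableSpace Ω] (P : Measure Ω) [IsProbabilityMeasure P]
    (X : ℕ → Ω → Plane) (θ : ℕ → Ω → ℝ) (lamp d Rcs Rtx : ℝ)
    (hlam : 0 < lamp) (hd : 0 < d) (hRtx : 0 < Rtx) (hR : Rtx < Rcs)
    (hbip : DualZone.IsPoissonBipolar P X θ lamp) :
    (∀ (x : Plane) (t : ℝ), volume (DualZone.exclusionRegion d Rcs Rtx x t) =
      ENNReal.ofReal (DualZone.exclusionArea d Rcs Rtx)) ∧
    DualZone.HasIntensity P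
      (fun ω => DualZone.activeTransmitters d Rcs Rtx (DualZone.markedSet X θ ω))
      (ENNReal.ofReal (lamp * Real.exp (-(lamp * DualZone.exclusionArea d Rcs Rtx)))) ∧
    (∀ B : Set Plane, MeasurableSet B → 0 < volume B → volume B < ∞ →
      DualZone.HasIntensity P
        (fun ω => DualZone.activeTransmitters d Rcs Rtx (DualZone.markedSet X θ ω))
        (ENNReal.ofReal lamp * DualZone.palmProb P (DualZone.markedSet X θ) lamp B
          {ψ | (0 : Plane) ∈ DualZone.activeTransmitters d Rcs Rtx ψ}) ∧
      DualZone.palmProb P (DualZone.markedSet X θ) lamp B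
          {ψ | (0 : Plane) ∈ DualZone.activeTransmitters d Rcs Rtx ψ} =
        ENNReal.ofReal (Real.exp (-(lamp * DualZone.exclusionArea d Rcs Rtx)))) := by
  have hRcs : 0 < Rcs := hRtx.trans hR
  have hint := hbip.hasIntensity hlam.le hd hRcs hRtx
  refine ⟨DualZone.volume_exclusionRegion hd hRcs hRtx, hint, fun B hB hpos hfin => ?_⟩
  have hpalm := hbip.palmProb_eq hlam hd hRcs hRtx hB hpos hfin
  rw [hpalm, ← ENNReal.ofReal_mul hlam.le]
  exact ⟨hint, rfl⟩
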